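/- Let $n\ge 1$, let $K=\mathbb C(\lambda)$ be the field of rational functions in $\lambda$, and let $F_\lambda=x_1^n+\cdots+x_n^n-n\lambda x_1\cdots x_n$. For $w=(w_1,\dots,w_n)$ with all $w_i\ge 0$ write $x^w=x_1^{w_1}\cdots x_n^{w_n}$. Let $\mathfrak L$ be the $K$-vector space with basis the monomials $x^w$ with all $w_i\geq 0$ and $\sum_i w_i\equiv 0\pmod n$, and let $\mathfrak L^S\subseteq\mathfrak L$ be the subspace spanned by those $x^w$ with all $w_i\ge 1$. Let $D_i:\mathfrak L\to\mathfrak L$ be the $K$-linear map $$D_i(x^w)=w_ix^w+x_i\frac{\partial F_\lambda}{\partial x_i}x^w=w_ix^w+n x_i^nx^w-n\lambda x_1\cdots x_n x^w ,$$ and put $\mathcal W=\mathfrak L^S/\bigl(\mathfrak L^S\cap\sum_{i=1}^n D_i\mathfrak L\bigr)$. Let $\mathcal B$ be the set of monomials $x^w$ with $1\le w_i\le n-1$ for all $i$ and $\sum_i w_i\equiv 0\pmod n$. *Reduction algorithm.* The input is a term $c*w$ with $c\in K$ and $x^w\in\mathfrak L^S$. The algorithm keeps two lists of terms, $L$ (finished)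 and $M$ (still to be reduced), both empty at the start. A term is filed by putting it in $L$ if all its exponents are $<n$ and in $M$ otherwise; it is appended, or, if its exponent already occurs in that list, its coefficient is added to the existing one. If $t=c*w$ is a term with some $w_i\ge n$, let $i$ be the first such index and put $$u(t)=c\lambda*(w_1+1,\dots,w_i-n+1,\dots,w_n+1),\qquad v(t)=c\,\tfrac{n-w_i}{n}*(w_1,\dots,w_i-n,\dots,w_n).$$ The leftover of $t$ is $v(t)$; it is discarded when $w_i=n$. 1. Starting with the input term $t_0$, form the diagonal $t_0$, $t_1=u(t_0)$, $t_2=u(t_1),\dots$ until either (a) a term $t_k$ is met all of whose exponents are $<n$, or (b) a term $t_k$ is met whose exponent is that of an earlier term $t_j$ of the same diagonal. 2. In case (a) file the leftovers of $t_0,\dots,t_{k-1}$, and file $t_k$. In case (b) divide the coefficients of $t_j,\dots,t_{k-1}$ by $1-\lambda^n$, and then file the leftovers of $t_0,\dots,t_{k-1}$. 3. If $M$ is empty, stop and output $L$. Otherwise remove the first term of $M$ and go to step 1 with it as the new starting term. Then: (i) For every $c\in K$ and every $w$ with $x^w\in\mathfrak L^S$, the reduction algorithm with input $c*w$ stops after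 finitely many steps. All terms $c'*w'$ of its output list $L$ satisfy $x^{w'}\in\mathcal B$, and $c\,x^w=\sum_{c'*w'\in L}c'\,x^{w'}$ in $\mathcal W$. (ii) $\mathcal W$ is spanned over $K$ by the classes of the monomials in $\mathcal B$. (iii) $\mathcal W$ is finite dimensional over $K$, and $$\dim_K\mathcal W=\sum_{k=1}^{n-1}(-1)^{n-1-k}(n-1)^k=(n-1)^{n-1}-(n-1)^{n-2}+(n-1)^{n-3}-\cdots\pm(n-1).$$ -/

import Mathlib

namespace Dwork

open MvPolynomial

/-- The field `ℂ(λ)` of rational functions. -/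
abbrev K : Type := RatFunc ℂ

/-- The indeterminate `λ` of `ℂ(λ)`. -/
noncomputable abbrev lam : K := RatFunc.X

/-- The monomial `x^w = x_1^{w_1} ⋯ x_n^{w_n}`. -/
noncomputable def mono {n : ℕ} (w : Fin n → ℕ) : MvPolynomial (Fin n) K :=
  ∏ i, X i ^ w i

/-- The Dwork polynomial `F_λ = x_1^n + ⋯ + x_n^n - n λ x_1 ⋯ x_n`. -/
noncomputable def F (n : ℕ) : MvPolynomial (Fin n) K :=
  ∑ i, X i ^ n - C ((n : K) * lam) * ∏ i, X i

/-- The module `𝔏`: the `ℂ(λ)`-span of the (linearly independent) monomials `x^w` with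
all `w_i ≥ 0` and `n ∣ ∑ w_i`. -/
noncomputable def L (n : ℕ) : Submodule K (MvPolynomial (Fin n) K) :=
  Submodule.span K {p | ∃ w : Fin n → ℕ, n ∣ ∑ i, w i ∧ p = mono w}

/-- The exponents of the monomials in `𝔏^S`: all `w_i ≥ 1` and `n ∣ ∑ w_i`. -/
def IsPosExp {n : ℕ} (w : Fin n → ℕ) : Prop :=
  (∀ i, 1 ≤ w i) ∧ n ∣ ∑ i, w i

/-- The exponents of the set `𝓑`: `1 ≤ w_i ≤ n - 1` and `n ∣ ∑ w_i`. -/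
def IsBoxExp {n : ℕ} (w : Fin n → ℕ) : Prop :=
  (∀ i, 1 ≤ w i ∧ w i ≤ n - 1) ∧ n ∣ ∑ i, w i

theorem IsBoxExp.isPosExp {n : ℕ} {w : Fin n → ℕ} (h : IsBoxExp w) : IsPosExp w :=
  ⟨fun i => (h.1 i).1, h.2⟩

/-- The module `𝔏^S`. -/
noncomputable def LS (n : ℕ) : Submodule K (MvPolynomial (Fin n) K) :=
  Submodule.span K {p | ∃ w : Fin n → ℕ, IsPosExp w ∧ p = mono w}

/-- The operator `D_i p = x_i ∂p/∂x_i + x_i (∂F_λ/∂x_i) p`. -/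
noncomputable def D {n : ℕ} (i : Fin n) :
    MvPolynomial (Fin n) K →ₗ[K] MvPolynomial (Fin n) K :=
  (LinearMap.mulLeft K (X i)).comp (pderiv i).toLinearMap +
    LinearMap.mulLeft K (X i * pderiv i (F n))

/-- `∑ i, D_i 𝔏`. -/
noncomputable def relations (n : ℕ) : Submodule K (MvPolynomial (Fin n) K) :=
  ⨆ i : Fin n, (L n).map (D i)

/-- Dwork's module `𝓦 = 𝔏^S / (𝔏^S ∩ ∑ i, D_i 𝔏)`. -/
abbrev W (n : ℕ) : Type :=
  LS n ⧸ (relations n).comap (LS n).subtype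

/-- The class of the monomial `x^w` in `𝓦`, for `x^w` in `𝔏^S`. -/
noncomputable def cls {n : ℕ} (w : Fin n → ℕ) (hw : IsPosExp w) : W n :=
  Submodule.Quotient.mk ⟨mono w, Submodule.subset_span ⟨w, hw, rfl⟩⟩

/-! Two checks: on monomials `D_i` is the operator
`x^w ↦ w_i x^w + n x_i^n x^w - n λ x_1 ⋯ x_n x^w`, and it maps `𝔏` to itself. -/

theorem X_mul_pderiv_mono {n : ℕ} (i : Fin n) (w : Fin n → ℕ) :
    X i * pderiv i (mono w) = (w i : K) • mono w := by
  have h : mono w = monomial (Finsupp.equivFunOnFinite.symm w) (1 : K) := by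
    rw [monomial_eq, Finsupp.prod_fintype _ _ (fun _ => pow_zero _)]
    simp [mono]
  rw [h, X_mul_pderiv_monomial]
  simp [Nat.cast_smul_eq_nsmul]

theorem X_mul_pderiv_F {n : ℕ} (i : Fin n) :
    X i * pderiv i (F n) =
      C (n : K) * X i ^ n - C ((n : K) * lam) * ∏ j, (X j : MvPolynomial (Fin n) K) := by
  have h1 := X_mul_pderiv_mono i (fun _ : Fin n => 1)
  have h2 : X i * pderiv i (∑ j : Fin n, (X j : MvPolynomial (Fin n) K) ^ n) =
      C (n : K) * X i ^ n := by
    rw [map_sum, Finset.sum_eq_single i]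
    · have hn : n ≠ 0 := by
        rintro rfl
        exact i.elim0
      obtain ⟨m, rfl⟩ := Nat.exists_eq_succ_of_ne_zero hn
      simp
      ring
    · intro j _ hj
      simp [pderiv_X_of_ne hj]
    · simp
  simp only [mono, pow_one, Nat.cast_one, one_smul] at h1
  rw [F, map_sub, mul_sub, h2, pderiv_C_mul, mul_left_comm (X i) (C _), h1]

theorem D_mono {n : ℕ} (i : Fin n) (w : Fin n → ℕ) :
    D i (mono w) = (w i : K) • mono w + C (n : K) * X i ^ n * mono w -
      C ((n : K) * lam) * (∏ j, X j) * mono w := by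
  have h : D i (mono w) = X i * pderiv i (mono w) + X i * pderiv i (F n) * mono w := rfl
  rw [h, X_mul_pderiv_mono, X_mul_pderiv_F]
  ring

theorem map_D_le {n : ℕ} (i : Fin n) : (L n).map (D i) ≤ L n := by
  rw [L, Submodule.map_span_le]
  rintro _ ⟨w, hw, rfl⟩
  have e1 : X i ^ n * mono w = mono (fun j => (if j = i then n else 0) + w j) := by
    simp only [mono, pow_add, Finset.prod_mul_distrib, pow_ite, pow_zero]
    simp
  have e2 : (∏ j, (X j : MvPolynomial (Fin n) K)) * mono w = mono (fun j => 1 + w j) := by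
    simp [mono, pow_add, Finset.prod_mul_distrib]
  rw [D_mono, mul_assoc, mul_assoc, C_mul', C_mul', e1, e2]
  refine Submodule.sub_mem _ (Submodule.add_mem _ ?_ ?_) ?_ <;>
    refine Submodule.smul_mem _ _ (Submodule.subset_span ⟨_, ?_, rfl⟩)
  · exact hw
  · simpa [Finset.sum_add_distrib] using hw
  · simpa [Finset.sum_add_distrib] using hw

/-! ### The reduction algorithm -/

/-- A term `c * w`: a coefficient and an exponent. -/
abbrev Term (n : ℕ) : Type := K × (Fin n → ℕ)

/-- The first index `i` with `w_i ≥ n`, if there is one. -/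
def firstLarge {n : ℕ} (w : Fin n → ℕ) : Option (Fin n) :=
  (List.finRange n).find? (fun i => decide (n ≤ w i))

/-- `u = c λ * (w_1 + 1, …, w_i - n + 1, …, w_n + 1)`; used only when `w_i ≥ n`. -/
noncomputable def uTerm {n : ℕ} (t : Term n) (i : Fin n) : Term n :=
  (t.1 * lam, fun j => if j = i then t.2 j + 1 - n else t.2 j + 1)

/-- `v = c (n - w_i) / n * (w_1, …, w_i - n, …, w_n)`; used only when `w_i ≥ n`. -/
noncomputable def vTerm {n : ℕ} (t : Term n) (i : Fin n) : Term n :=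
  (t.1 * (((n : K) - (t.2 i : K)) / (n : K)), fun j => if j = i then t.2 j - n else t.2 j)

/-- Append a term to a list, or, if its exponent already occurs there, add the
coefficient to the existing one. -/
noncomputable def addTerm {n : ℕ} (t : Term n) : List (Term n) → List (Term n)
  | [] => [t]
  | s :: l => if s.2 = t.2 then (s.1 + t.1, s.2) :: l else s :: addTerm t l

/-- Put a term into the first list (finished terms) if all its exponents are `< n`, and
into the second list (terms still to be reduced) otherwise. -/
noncomputable def file {n : ℕ} (LM : List (Term n) × List (Term n)) (t : Term n) :
    List (Term n) × List (Term n) :=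
  if firstLarge t.2 = none then (addTerm t LM.1, LM.2) else (LM.1, addTerm t LM.2)

/-- File the leftover `v` of a term `c * w` with some `w_i ≥ n`, unless the factor
`(n - w_i) / n` is zero. -/
noncomputable def fileLeftover {n : ℕ} (LM : List (Term n) × List (Term n)) (t : Term n) :
    List (Term n) × List (Term n) :=
  match firstLarge t.2 with
  | none => LM
  | some i => if t.2 i = n then LM else file LM (vTerm t i)

/-- A state of the algorithm. In `running Lst Mst T a`, `Lst` is the list of finished terms,
`Mst` the list of terms still to be reduced, `a` the term being looked at, and `T` the list
(in order) of the terms met before `a` on the present diagonal, each being the `u` of the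
one before it. In `halted Lst` the algorithm has stopped with output `Lst`. -/
inductive State (n : ℕ) : Type
  | running (Lst Mst T : List (Term n)) (a : Term n) : State n
  | halted (Lst : List (Term n)) : State n

/-- Take the first term of the second list as the start of a new diagonal; output the first
list if the second one is empty. -/
def next {n : ℕ} : List (Term n) × List (Term n) → State n
  | (Lst, []) => .halted Lst
  | (Lst, a :: Mst) => .running Lst Mst [] a

/-- One step of the algorithm, looking at the term `a = c * w`.
* If all `w_i < n`, the diagonal ends: file the leftovers of its terms and `a` itself.
* If `w` is the exponent of the `j`-th term of the diagonal, the diagonal has closed up: file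
  the leftovers of its terms, where the coefficients from the `j`-th term on are divided
  by `1 - λ^n`.
* Otherwise, go on to `u`. -/
noncomputable def step {n : ℕ} : State n → State n
  | .halted Lst => .halted Lst
  | .running Lst Mst T a =>
    match firstLarge a.2 with
    | none => next (file (T.foldl fileLeftover (Lst, Mst)) a)
    | some i =>
      let j := T.findIdx (fun t => decide (t.2 = a.2))
      if j < T.length then
        next ((T.take j ++ (T.drop j).map (fun t => (t.1 / (1 - lam ^ n), t.2))).foldl
          fileLeftover (Lst, Mst))
      else
        .running Lst Mst (T ++ [a]) (uTerm a i)

/-- The algorithm on input `c * w` stops after finitely many steps, with output `out`. -/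
def Outputs {n : ℕ} (c : K) (w : Fin n → ℕ) (out : List (Term n)) : Prop :=
  ∃ N : ℕ, step^[N] (.running [] [] [] (c, w)) = .halted out

end Dwork

/-! Spanning comes from the algorithm, linear independence from formal periods, and the dimension
from counting `𝓑` by a two-term recursion.

On exponents, a diagonal is chip-firing on the complete graph: `w_i` drops by `n - 1`, all other
entries grow by `1`, and the total is conserved. If it never stabilizes, compare consecutive firings
of the last vertex: either that vertex has lost chips, or every vertex has fired exactly once and
the configuration has returned (`exists_return`). Hence each diagonal stabilizes or closes up after
exactly `n` steps (`diagonal_ends`). Modulo relations `t` equals `u(t) + v(t)`, so a diagonal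
telescopes; around a loop the coefficient gains the factor `λ^n`, and dividing by `1 - λ^n`
expresses the loop through its leftovers. Leftovers have smaller degree, so the waiting list
descends in the Dershowitz–Manna order (`exists_step_iterate_eq_halted`).

For independence, expand `exp(-nλ x_1⋯x_n)` and integrate termwise against products of one-variable
functionals. The resulting series in `λ` vanish on the image of every `D_i` (`period_D`), and the
period matrix indexed by `𝓑` is the identity at `λ = 0`, hence nonsingular
(`linearIndependent_cls`). -/

namespace Dwork

open MvPolynomial
open scoped RatFunc

/-! ### Formal periods and linear independence -/

/-- The functional on `ℂ[x]` (given by its values on the powers of `x`) that kills the image of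
`x d/dx + n x ^ n` and is dual to `x ^ r` for `r < n`. -/
noncomputable def moment (n r w : ℕ) : ℂ :=
  if w % n = r then ∏ l ∈ Finset.range (w / n), -(((r + n * l : ℕ) : ℂ) / n) else 0

/-- Integration by parts in one variable: passing from `w` to `w + n` appends the factor `-w / n` to
the product. -/
theorem moment_add {n : ℕ} (hn : 1 ≤ n) (r w : ℕ) :
    (n : ℂ) * moment n r (w + n) = -(w : ℂ) * moment n r w := by
  have h0 : (n : ℂ) ≠ 0 := by exact_mod_cast (by omega : n ≠ 0)
  unfold moment
  rw [Nat.add_mod_right, Nat.add_div_right w (by omega)]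
  split_ifs with h
  · rw [Finset.prod_range_succ, ← h, Nat.mod_add_div]
    field_simp
  · simp

theorem moment_of_lt {n r w : ℕ} (hw : w < n) : moment n r w = if w = r then 1 else 0 := by
  simp [moment, Nat.mod_eq_of_lt hw, Nat.div_eq_of_lt hw]

/-- The power series in `λ` obtained by integrating `x ^ w exp F_λ` termwise against a product of
one-variable moment functionals. -/
noncomputable def periodSeries {n : ℕ} (v w : Fin n → ℕ) : PowerSeries ℂ :=
  PowerSeries.mk fun m => (-(n : ℂ)) ^ m / (m.factorial : ℂ) * ∏ i, moment n (v i) (w i + m)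

theorem prod_moment_add {n : ℕ} (hn : 1 ≤ n) (v w : Fin n → ℕ) (i : Fin n) (m : ℕ) :
    (n : ℂ) * ∏ j, moment n (v j) ((if j = i then n else 0) + w j + m) =
      -((w i + m : ℕ) : ℂ) * ∏ j, moment n (v j) (w j + m) := by
  rw [Fintype.prod_eq_mul_prod_compl i, Fintype.prod_eq_mul_prod_compl i, ← mul_assoc, ← mul_assoc,
    ← moment_add hn]
  congr 1
  · simp only [if_true]
    congr 2
    ring
  · refine Finset.prod_congr rfl fun j hj => ?_
    have : j ≠ i := by simpa using hj
    simp [this]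

/-- In degree `m`, integration by parts in `x_i` turns the second term into `-(w_i + m)` times the
coefficient of the first series. The remaining `-m` cancels against the third term, because `m / m!
= 1 / (m - 1)!`. -/
theorem periodSeries_relation {n : ℕ} (hn : 1 ≤ n) (v w : Fin n → ℕ) (i : Fin n) :
    PowerSeries.C (w i : ℂ) * periodSeries v w +
      PowerSeries.C (n : ℂ) * periodSeries v (fun j => (if j = i then n else 0) + w j) -
      PowerSeries.C (n : ℂ) * (PowerSeries.X * periodSeries v (fun j => 1 + w j)) = 0 := by
  ext m
  simp only [map_sub, map_add, PowerSeries.coeff_C_mul, map_zero]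
  cases m with
  | zero =>
    have := prod_moment_add hn v w i 0
    simp only [add_zero] at this
    simp [periodSeries, this]
  | succ m =>
    rw [PowerSeries.coeff_succ_X_mul]
    simp only [periodSeries, PowerSeries.coeff_mk]
    have h1 := prod_moment_add hn v w i (m + 1)
    have h2 : ∏ j, moment n (v j) (1 + w j + m) = ∏ j, moment n (v j) (w j + (m + 1)) :=
      Finset.prod_congr rfl fun j _ => by congr 1; ring
    have h3 : (m.factorial : ℂ) ≠ 0 := by exact_mod_cast m.factorial_ne_zero
    have h4 : (m : ℂ) + 1 ≠ 0 := by exact_mod_cast m.succ_ne_zero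
    rw [h2, mul_left_comm (n : ℂ), h1, Nat.factorial_succ]
    push_cast
    field_simp
    ring

/-- A formal period of the Dwork family, as a functional on all polynomials. -/
noncomputable def period {n : ℕ} (v : Fin n → ℕ) :
    MvPolynomial (Fin n) K →ₗ[K] LaurentSeries ℂ :=
  (MvPolynomial.basisMonomials (Fin n) K).constr K
    fun s => (periodSeries v s : LaurentSeries ℂ)

theorem mono_eq_monomial {n : ℕ} (w : Fin n → ℕ) :
    mono w = monomial (Finsupp.equivFunOnFinite.symm w) (1 : K) := by
  rw [monomial_eq, Finsupp.prod_fintype _ _ (fun _ => pow_zero _)]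
  simp [mono]

theorem period_mono {n : ℕ} (v w : Fin n → ℕ) :
    period v (mono w) = (periodSeries v w : LaurentSeries ℂ) := by
  have h : mono w =
      MvPolynomial.basisMonomials (Fin n) K (Finsupp.equivFunOnFinite.symm w) := by
    rw [mono_eq_monomial, MvPolynomial.coe_basisMonomials]
  rw [h, period, Module.Basis.constr_basis]
  rfl

theorem X_pow_mul_mono {n : ℕ} (i : Fin n) (w : Fin n → ℕ) :
    X i ^ n * mono w = mono (fun j => (if j = i then n else 0) + w j) := by
  simp only [mono, pow_add, Finset.prod_mul_distrib, pow_ite, pow_zero]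
  simp

theorem prod_X_mul_mono {n : ℕ} (w : Fin n → ℕ) :
    (∏ j, (X j : MvPolynomial (Fin n) K)) * mono w = mono (fun j => 1 + w j) := by
  simp [mono, pow_add, Finset.prod_mul_distrib]

theorem D_mono_eq {n : ℕ} (i : Fin n) (w : Fin n → ℕ) :
    D i (mono w) = (w i : K) • mono w +
      (n : K) • mono (fun j => (if j = i then n else 0) + w j) -
      ((n : K) * lam) • mono (fun j => 1 + w j) := by
  rw [D_mono, mul_assoc, mul_assoc, C_mul', C_mul', X_pow_mul_mono, prod_X_mul_mono]

theorem period_D {n : ℕ} (hn : 1 ≤ n) (v : Fin n → ℕ) (i : Fin n)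
    (p : MvPolynomial (Fin n) K) : period v (D i p) = 0 := by
  have key : (period v).comp (D i) = 0 := by
    refine (MvPolynomial.basisMonomials (Fin n) K).ext fun s => ?_
    have hs : MvPolynomial.basisMonomials (Fin n) K s = mono s := by
      rw [mono_eq_monomial, MvPolynomial.coe_basisMonomials]
      congr 1
      simp
    rw [hs, LinearMap.comp_apply, D_mono_eq, map_sub, map_add, map_smul, map_smul, map_smul,
      period_mono, period_mono, period_mono, LinearMap.zero_apply]
    have h := congrArg (fun q : PowerSeries ℂ => (q : LaurentSeries ℂ))
      (periodSeries_relation hn v s i)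
    simp only [PowerSeries.coe_sub, PowerSeries.coe_add, PowerSeries.coe_mul, PowerSeries.coe_X,
      PowerSeries.coe_zero] at h
    have hX : algebraMap K (LaurentSeries ℂ) lam = HahnSeries.single (1 : ℤ) (1 : ℂ) := by
      exact RatFunc.coe_X
    simp only [Algebra.smul_def, map_mul, map_natCast] at h ⊢
    rw [hX, mul_assoc]
    simpa using h
  simpa using LinearMap.congr_fun key p

theorem period_of_mem_relations {n : ℕ} (hn : 1 ≤ n) (v : Fin n → ℕ)
    {p : MvPolynomial (Fin n) K} (hp : p ∈ relations n) : period v p = 0 := by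
  have : relations n ≤ LinearMap.ker (period v) := by
    refine iSup_le fun i => ?_
    rintro _ ⟨q, -, rfl⟩
    exact period_D hn v i q
  exact this hp

/-- The exponents of `𝓑` as a finite set. -/
def boxFinset (n : ℕ) : Finset (Fin n → ℕ) :=
  (Fintype.piFinset fun _ : Fin n => Finset.Icc 1 (n - 1)).filter fun w => n ∣ ∑ i, w i

theorem mem_boxFinset {n : ℕ} {w : Fin n → ℕ} : w ∈ boxFinset n ↔ IsBoxExp w := by
  simp [boxFinset, IsBoxExp]

/-- At `λ = 0` only the term `m = 0` survives, and below `n` the moments are Kronecker deltas. -/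
theorem constantCoeff_periodSeries {n : ℕ} (v w : Fin n → ℕ) (hw : ∀ i, w i < n) :
    PowerSeries.constantCoeff (periodSeries v w) = if v = w then 1 else 0 := by
  rw [← PowerSeries.coeff_zero_eq_constantCoeff_apply]
  simp only [periodSeries, PowerSeries.coeff_mk, pow_zero, Nat.factorial_zero, Nat.cast_one,
    div_one, one_mul, add_zero]
  rw [Finset.prod_congr rfl fun i _ => moment_of_lt (hw i)]
  simp [Finset.prod_ite_zero, funext_iff, eq_comm]

/-- The coefficients of a linear relation form a vector killed by the period matrix, whose
determinant has constant term `1`. -/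
theorem linearIndependent_cls {n : ℕ} (hn : 1 ≤ n) :
    LinearIndependent K (fun w : boxFinset n => cls w.1 (mem_boxFinset.1 w.2).isPosExp) := by
  rw [Fintype.linearIndependent_iff]
  intro a ha
  have hrel : ∑ w : boxFinset n, a w • mono w.1 ∈ relations n := by
    have h : (Submodule.Quotient.mk (∑ w : boxFinset n, a w •
        (⟨mono w.1, Submodule.subset_span ⟨w.1, (mem_boxFinset.1 w.2).isPosExp, rfl⟩⟩ : LS n)) :
        W n) = 0 := by
      rw [← ha, ← Submodule.mkQ_apply, map_sum]
      rfl
    rw [Submodule.Quotient.mk_eq_zero, Submodule.mem_comap, map_sum] at h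
    exact h
  let M : Matrix (boxFinset n) (boxFinset n) (PowerSeries ℂ) :=
    fun v w => periodSeries v.1 w.1
  have hM : M.det ≠ 0 := by
    have h0 : PowerSeries.constantCoeff.mapMatrix M = 1 := by
      ext v w
      rw [RingHom.mapMatrix_apply, Matrix.map_apply, Matrix.one_apply,
        constantCoeff_periodSeries _ _ fun i => by
          have := (mem_boxFinset.1 w.2).1 i; omega]
      simp only [Subtype.ext_iff]
    have h1 : PowerSeries.constantCoeff M.det = 1 := by
      rw [RingHom.map_det, h0, Matrix.det_one]
    intro h
    rw [h, map_zero] at h1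
    exact zero_ne_one h1
  have hM' : (M.map (HahnSeries.ofPowerSeries ℤ ℂ)).det ≠ 0 := by
    rw [← RingHom.mapMatrix_apply, ← RingHom.map_det]
    exact (map_ne_zero_iff _ HahnSeries.ofPowerSeries_injective).2 hM
  have hz := Matrix.eq_zero_of_mulVec_eq_zero hM'
    (v := fun w => algebraMap K (LaurentSeries ℂ) (a w)) <| by
      ext1 v
      have h := period_of_mem_relations hn v.1 hrel
      rw [map_sum] at h
      simp only [map_smul, period_mono] at h
      simp only [Algebra.smul_def] at h
      rw [Pi.zero_apply, ← h]
      exact Finset.sum_congr rfl fun w _ => mul_comm _ _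
  intro w
  exact (map_eq_zero_iff _ (algebraMap K (LaurentSeries ℂ)).injective).1 (congrFun hz w)

end Dwork

/-! ### The cardinality of `𝓑` -/

namespace Dwork

/-- The vectors in `{1, …, n - 1} ^ m` whose sum is divisible by `n`. -/
def boxVectors (n m : ℕ) : Finset (Fin m → ℕ) :=
  (Fintype.piFinset fun _ : Fin m => Finset.Icc 1 (n - 1)).filter fun w => n ∣ ∑ i, w i

/-- Deleting the first entry is a bijection onto the vectors with sum not divisible by `n`: the
deleted entry is recovered as `n` minus the residue of that sum, which lies in `1, …, n - 1` exactly
when the residue is nonzero. -/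
theorem card_boxVectors_succ {n : ℕ} (hn : 1 ≤ n) (m : ℕ) :
    (boxVectors n (m + 1)).card + (boxVectors n m).card = (n - 1) ^ m := by
  have h1 : (boxVectors n (m + 1)).card =
      ((Fintype.piFinset fun _ : Fin m => Finset.Icc 1 (n - 1)).filter
        fun w => ¬ n ∣ ∑ i, w i).card := by
    refine Finset.card_bij' (fun w _ => Fin.tail w)
      (fun w _ => Fin.cons (n - (∑ i, w i) % n) w) ?_ ?_ ?_ ?_
    · intro w hw
      simp only [boxVectors, Finset.mem_filter, Fintype.mem_piFinset, Finset.mem_Icc,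
        Fin.sum_univ_succ] at hw ⊢
      refine ⟨fun i => hw.1 i.succ, fun h => ?_⟩
      have h2 := (Nat.dvd_add_left h).1 hw.2
      have h3 := hw.1 0
      have := Nat.le_of_dvd (by omega) h2
      omega
    · intro w hw
      simp only [boxVectors, Finset.mem_filter, Fintype.mem_piFinset, Finset.mem_Icc,
        Fin.sum_univ_succ, Fin.cons_zero, Fin.cons_succ] at hw ⊢
      have h0 : (∑ i, w i) % n ≠ 0 := fun h => hw.2 (Nat.dvd_of_mod_eq_zero h)
      have hlt : (∑ i, w i) % n < n := Nat.mod_lt _ (by omega)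
      refine ⟨fun i => ?_, ?_⟩
      · refine Fin.cases ?_ (fun j => ?_) i
        · simp only [Fin.cons_zero]; omega
        · simpa using hw.1 j
      · have := Nat.mod_add_div (∑ i, w i) n
        exact ⟨(∑ i, w i) / n + 1, by rw [mul_add, mul_one]; omega⟩
    · intro w hw
      simp only [boxVectors, Finset.mem_filter, Fintype.mem_piFinset, Finset.mem_Icc,
        Fin.sum_univ_succ] at hw
      have h3 := hw.1 0
      obtain ⟨q, hq⟩ := hw.2
      have hs : (∑ i, Fin.tail w i) % n = n - w 0 := by
        have hq1 : 1 ≤ q := by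
          rcases q with - | q
          · omega
          · omega
        obtain ⟨q, rfl⟩ := Nat.exists_eq_add_of_le' hq1
        have : ∑ i, Fin.tail w i = (n - w 0) + n * q := by
          simp only [Fin.tail]
          rw [mul_add, mul_one] at hq
          omega
        rw [this, Nat.add_mul_mod_self_left, Nat.mod_eq_of_lt (by omega)]
      rw [hs, Nat.sub_sub_self (by omega)]
      exact Fin.cons_self_tail w
    · intro w _
      simp
  rw [h1, boxVectors, add_comm, Finset.card_filter_add_card_filter_not]
  simp

theorem card_boxVectors {n : ℕ} (hn : 1 ≤ n) (m : ℕ) :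
    ((boxVectors n (m + 1)).card : ℤ) =
      ∑ k ∈ Finset.Icc 1 m, (-1 : ℤ) ^ (m - k) * ((n : ℤ) - 1) ^ k := by
  induction m with
  | zero =>
    have h := card_boxVectors_succ hn 0
    have h0 : (boxVectors n 0).card = 1 := by simp [boxVectors]
    simp only [Finset.Icc_eq_empty_of_lt zero_lt_one, Finset.sum_empty]
    rw [h0, pow_zero] at h
    exact_mod_cast (by omega : (boxVectors n (0 + 1)).card = 0)
  | succ m ih =>
    have h := congrArg (Nat.cast : ℕ → ℤ) (card_boxVectors_succ hn (m + 1))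
    push_cast [Nat.cast_sub hn] at h
    rw [ih] at h
    rw [Finset.sum_Icc_succ_top (by omega), eq_sub_of_add_eq h, sub_eq_add_neg, add_comm,
      ← Finset.sum_neg_distrib]
    congr 1
    · refine Finset.sum_congr rfl fun k hk => ?_
      rw [Finset.mem_Icc] at hk
      rw [Nat.succ_sub hk.2, pow_succ]
      ring
    · simp

theorem card_boxFinset {n : ℕ} (hn : 1 ≤ n) :
    ((boxFinset n).card : ℤ) =
      ∑ k ∈ Finset.Icc 1 (n - 1), (-1 : ℤ) ^ (n - 1 - k) * ((n : ℤ) - 1) ^ k := by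
  obtain ⟨m, rfl⟩ := Nat.exists_eq_add_of_le' hn
  exact card_boxVectors hn m

end Dwork

/-! ### Chip-firing: how a diagonal ends -/

namespace Dwork

open Function

theorem firstLarge_eq_none {n : ℕ} {w : Fin n → ℕ} : firstLarge w = none ↔ ∀ i, w i < n := by
  simp [firstLarge]

theorem firstLarge_eq_some {n : ℕ} {w : Fin n → ℕ} {i : Fin n} (h : firstLarge w = some i) :
    n ≤ w i ∧ ∀ j < i, w j < n := by
  obtain ⟨h1, k, hk, h2, h3⟩ := List.find?_eq_some_iff_getElem.1 h
  simp only [List.getElem_finRange, decide_eq_true_eq] at h1 h2 h3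
  refine ⟨h1, fun j hj => ?_⟩
  have hjk : (j : ℕ) < k := by
    subst h2
    exact hj
  simpa using h3 j hjk

theorem exists_firstLarge_eq_some {n : ℕ} {w : Fin n → ℕ} (h : firstLarge w ≠ none) :
    ∃ i, firstLarge w = some i :=
  Option.ne_none_iff_exists'.1 h

/-- The exponent of `u`: fire the first vertex with at least `n` chips on the complete graph. A
stable configuration is left alone. -/
def fire {n : ℕ} (w : Fin n → ℕ) : Fin n → ℕ :=
  match firstLarge w with
  | none => w
  | some i => fun j => if j = i then w j + 1 - n else w j + 1

theorem fire_of_eq_some {n : ℕ} {w : Fin n → ℕ} {i : Fin n} (h : firstLarge w = some i) :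
    fire w = fun j => if j = i then w j + 1 - n else w j + 1 := by
  rw [fire, h]

theorem fire_add {n : ℕ} {w : Fin n → ℕ} {i : Fin n} (h : firstLarge w = some i) (j : Fin n) :
    fire w j + (if j = i then n else 0) = w j + 1 := by
  have := (firstLarge_eq_some h).1
  rw [fire_of_eq_some h]
  dsimp only
  split_ifs with hj
  · subst hj
    omega
  · rfl

theorem sum_fire {n : ℕ} (w : Fin n → ℕ) : ∑ j, fire w j = ∑ j, w j := by
  rcases h : firstLarge w with - | i
  · rw [fire, h]
  · have h1 := Finset.sum_congr rfl fun j (_ : j ∈ Finset.univ) => fire_add h j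
    simp only [Finset.sum_add_distrib, Finset.sum_ite_eq', Finset.mem_univ, if_true,
      Finset.sum_const, Finset.card_univ, Fintype.card_fin, smul_eq_mul, mul_one] at h1
    omega

theorem sum_iterate_fire {n : ℕ} (w : Fin n → ℕ) (s : ℕ) :
    ∑ j, (fire^[s] w) j = ∑ j, w j := by
  induction s with
  | zero => rfl
  | succ s ih => rw [iterate_succ_apply', sum_fire, ih]

theorem IsPosExp.fire {n : ℕ} {w : Fin n → ℕ} (hw : IsPosExp w) : IsPosExp (fire w) := by
  refine ⟨fun j => ?_, by rw [sum_fire]; exact hw.2⟩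
  rcases h : firstLarge w with - | i
  · rw [Dwork.fire, h]
    exact hw.1 j
  · have h1 := fire_add h j
    have h2 := (firstLarge_eq_some h).1
    split_ifs at h1 with hj
    · subst hj
      omega
    · omega

theorem IsPosExp.iterate_fire {n : ℕ} {w : Fin n → ℕ} (hw : IsPosExp w) (s : ℕ) :
    IsPosExp (Dwork.fire^[s] w) := by
  induction s with
  | zero => exact hw
  | succ s ih =>
    rw [iterate_succ_apply']
    exact ih.fire

/-- Along an orbit of `fire`, all residues modulo `n` grow by `1` with each step. -/
theorem exists_iterate_fire_add {n : ℕ} {w : Fin n → ℕ} (j : Fin n) (d : ℕ)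
    (hns : ∀ s < d, firstLarge (fire^[s] w) ≠ none) :
    ∃ q, (fire^[d] w) j + n * q = w j + d := by
  induction d with
  | zero => exact ⟨0, rfl⟩
  | succ d ih =>
    obtain ⟨q, hq⟩ := ih fun s hs => hns s (by omega)
    obtain ⟨i, hi⟩ := exists_firstLarge_eq_some (hns d (by omega))
    have h := fire_add hi j
    rw [iterate_succ_apply']
    split_ifs at h
    · exact ⟨q + 1, by rw [mul_add, mul_one]; omega⟩
    · exact ⟨q, by omega⟩

/-- A vertex that never fires gains a chip at each step and eventually exceeds the conserved total.
-/
theorem exists_firstLarge_iterate_eq_some {n : ℕ} {w : Fin n → ℕ} (i : Fin n)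
    (hns : ∀ s, firstLarge (fire^[s] w) ≠ none) :
    ∃ s, firstLarge (fire^[s] w) = some i := by
  by_contra! hne
  have hgrow : ∀ s, (fire^[s] w) i = w i + s := by
    intro s
    induction s with
    | zero => rfl
    | succ s ih =>
      obtain ⟨k, hk⟩ := exists_firstLarge_eq_some (hns s)
      have h := fire_add hk i
      rw [if_neg fun hik : i = k => hne s (hik ▸ hk)] at h
      rw [iterate_succ_apply']
      omega
  have h1 := Finset.single_le_sum (f := fire^[∑ j, w j + 1] w) (fun j _ => Nat.zero_le _)
    (Finset.mem_univ i)
  rw [sum_iterate_fire, hgrow] at h1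
  omega

/-- Between two firings of the last vertex every other vertex fires at most once. -/
theorem exists_fired_set {n : ℕ} {y : Fin n → ℕ} {i : Fin n} (hi : ∀ j, j ≤ i)
    (hy : firstLarge y = some i) (hns : ∀ s, firstLarge (fire^[s] y) ≠ none) (g : ℕ)
    (hg : ∀ s, 1 ≤ s → s ≤ g → firstLarge (fire^[s] y) ≠ some i) :
    ∃ S : Finset (Fin n), S.card = g + 1 ∧ i ∈ S ∧
      ∀ j, (fire^[g + 1] y) j + (if j ∈ S then n else 0) = y j + (g + 1) := by
  induction g with
  | zero => exact ⟨{i}, rfl, by simp, fun j => by simpa using fire_add hy j⟩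
  | succ g ih =>
    obtain ⟨S, hS, hiS, h⟩ := ih fun s h1 h2 => hg s h1 (by omega)
    obtain ⟨k, hk⟩ := exists_firstLarge_eq_some (hns (g + 1))
    have hki : k ≠ i := fun hki => hg (g + 1) (by omega) le_rfl (hki ▸ hk)
    have hcard : S.card ≤ n := by simpa using S.card_le_univ
    -- Vertex `k` began below `n`, since the last vertex fires only when all others are small. After
    -- one firing and at most `n` steps it is still below `n`, so it cannot fire again.
    have hkS : k ∉ S := by
      intro hkS
      have h1 := h k
      have h2 := (firstLarge_eq_some hk).1
      have h3 := (firstLarge_eq_some hy).2 k (lt_of_le_of_ne (hi k) hki)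
      rw [if_pos hkS] at h1
      omega
    refine ⟨insert k S, by rw [Finset.card_insert_of_notMem hkS, hS], by simp [hiS], fun j => ?_⟩
    have h1 := h j
    have h2 := fire_add hk j
    rw [iterate_succ_apply']
    by_cases hj : j = k
    · subst hj
      rw [if_neg hkS] at h1
      rw [if_pos rfl] at h2
      rw [if_pos (Finset.mem_insert_self _ _)]
      omega
    · rw [if_neg hj] at h2
      simp only [Finset.mem_insert, hj, false_or]
      omega

/-- Look at the next firing of `i`, after `g + 1` steps. Exactly `g + 1` distinct vertices have
fired, so `g + 1 ≤ n`, and `i` has changed by `g + 1 - n`. Equality means that every vertex fired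
once, which restores `y`. -/
theorem exists_return {n : ℕ} {y : Fin n → ℕ} {i : Fin n} (hi : ∀ j, j ≤ i)
    (hy : firstLarge y = some i) (hns : ∀ s, firstLarge (fire^[s] y) ≠ none) :
    fire^[n] y = y ∨
      ∃ g, firstLarge (fire^[g] y) = some i ∧ (fire^[g] y) i < y i := by
  have hex : ∃ g, firstLarge (fire^[g + 1] y) = some i := by
    obtain ⟨g, hg⟩ := exists_firstLarge_iterate_eq_some (w := fire y) i fun s => by
      rw [← iterate_succ_apply]
      exact hns _
    exact ⟨g, by rwa [iterate_succ_apply]⟩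
  classical
  obtain ⟨S, hS, hiS, h⟩ := exists_fired_set hi hy hns (Nat.find hex) fun s h1 h2 => by
    obtain ⟨s, rfl⟩ := Nat.exists_eq_add_of_le' h1
    exact Nat.find_min hex h2
  have hg := Nat.find_spec hex
  generalize Nat.find hex = g at hS h hg
  have hcard : S.card ≤ n := by simpa using S.card_le_univ
  rcases Nat.lt_or_ge (g + 1) n with hlt | hge
  · right
    refine ⟨g + 1, hg, ?_⟩
    have := h i
    rw [if_pos hiS] at this
    omega
  · left
    have hgn : g + 1 = n := by omega
    have hSu : S = Finset.univ := by
      rw [← Finset.card_eq_iff_eq_univ, hS, hgn, Fintype.card_fin]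
    funext j
    have := h j
    rw [if_pos (by simp [hSu]), hgn] at this
    omega

theorem exists_iterate_fire_eq {n : ℕ} (hn : 1 ≤ n) {w : Fin n → ℕ}
    (hns : ∀ s, firstLarge (fire^[s] w) ≠ none) :
    ∃ s, fire^[n] (fire^[s] w) = fire^[s] w := by
  let i : Fin n := ⟨n - 1, by omega⟩
  have hi : ∀ j, j ≤ i := fun j => by
    have := j.2
    exact Fin.le_def.2 (by simp only [i]; omega)
  obtain ⟨s, hs⟩ := exists_firstLarge_iterate_eq_some i hns
  generalize hN : (fire^[s] w) i = N
  -- Descent on the number of chips at the last vertex when it fires.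
  induction N using Nat.strong_induction_on generalizing s with
  | _ N ih =>
    rcases exists_return hi hs fun r => by rw [← iterate_add_apply]; exact hns _ with h | ⟨g, hg, hlt⟩
    · exact ⟨s, h⟩
    · rw [← iterate_add_apply] at hg hlt
      exact ih _ (hN ▸ hlt) _ hg rfl

/-- Some point of the orbit is fixed by `fire^[n]`; following the cycle from there back to `x`
transports this to `x`. -/
theorem iterate_fire_of_periodic {n : ℕ} (hn : 1 ≤ n) {x : Fin n → ℕ} {d : ℕ} (hd : 0 < d)
    (hx : fire^[d] x = x) (hns : ∀ s < d, firstLarge (fire^[s] x) ≠ none) :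
    fire^[n] x = x := by
  have hper : IsPeriodicPt fire d x := hx
  have hns' : ∀ s, firstLarge (fire^[s] x) ≠ none := fun s => by
    rw [← hper.iterate_mod_apply]
    exact hns _ (Nat.mod_lt _ hd)
  obtain ⟨s, hs⟩ := exists_iterate_fire_eq hn hns'
  have h1 : fire^[d * s - s] (fire^[s] x) = x := by
    rw [← iterate_add_apply, Nat.sub_add_cancel (Nat.le_mul_of_pos_left s hd)]
    exact hper.mul_const s
  rw [← h1, ← iterate_add_apply, Nat.add_comm, iterate_add_apply, hs]

/-- Each diagonal ends at a stable exponent, or closes up in a loop of length exactly `n`. -/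
theorem diagonal_ends {n : ℕ} (hn : 1 ≤ n) (w : Fin n → ℕ) :
    ∃ k, (∀ s < k, firstLarge (fire^[s] w) ≠ none) ∧
      (∀ s' < k, ∀ s < s', fire^[s] w ≠ fire^[s'] w) ∧
      (firstLarge (fire^[k] w) = none ∨
        firstLarge (fire^[k] w) ≠ none ∧ ∃ j, k = j + n ∧ fire^[j] w = fire^[k] w) := by
  have hex : ∃ k, firstLarge (fire^[k] w) = none ∨ ∃ j < k, fire^[j] w = fire^[k] w := by
    by_cases h : ∀ s, firstLarge (fire^[s] w) ≠ none
    · obtain ⟨s, hs⟩ := exists_iterate_fire_eq hn h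
      exact ⟨n + s, Or.inr ⟨s, by omega, by rw [iterate_add_apply, hs]⟩⟩
    · push Not at h
      obtain ⟨s, hs⟩ := h
      exact ⟨s, Or.inl hs⟩
  classical
  obtain ⟨k, hk, hmin⟩ : ∃ k, (firstLarge (fire^[k] w) = none ∨
      ∃ j < k, fire^[j] w = fire^[k] w) ∧ ∀ s < k, firstLarge (fire^[s] w) ≠ none ∧
      ∀ j < s, fire^[j] w ≠ fire^[s] w :=
    ⟨Nat.find hex, Nat.find_spec hex, fun s hs => by
      have := Nat.find_min hex hs
      push Not at this
      exact this⟩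
  refine ⟨k, fun s hs => (hmin s hs).1, fun s' hs' s hs => (hmin s' hs').2 s hs, ?_⟩
  by_cases hst : firstLarge (fire^[k] w) = none
  · exact Or.inl hst
  refine Or.inr ⟨hst, ?_⟩
  obtain ⟨j, hjk, hj⟩ := hk.resolve_left hst
  obtain ⟨d, rfl⟩ := Nat.exists_eq_add_of_le hjk.le
  have hx : fire^[d] (fire^[j] w) = fire^[j] w := by
    rw [← iterate_add_apply, Nat.add_comm, ← hj]
  have hns : ∀ s < d, firstLarge (fire^[s] (fire^[j] w)) ≠ none := fun s hs => by
    rw [← iterate_add_apply]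
    exact (hmin _ (by omega)).1
  have hnx := iterate_fire_of_periodic hn (by omega) hx hns
  -- Residues modulo `n` grow by `1` per step, so the loop length `d` is a multiple of `n`. If it
  -- exceeded `n`, the repetition at `j + n` would contradict the minimality of `k`.
  obtain ⟨q, hq⟩ := exists_iterate_fire_add ⟨0, hn⟩ d hns
  rw [hx] at hq
  have hnd : n ≤ d := Nat.le_of_dvd (by omega) ⟨q, by omega⟩
  rcases hnd.eq_or_lt with rfl | hlt
  · exact ⟨j, rfl, hj⟩
  · refine absurd ?_ ((hmin (j + n) (by omega)).2 j (by omega))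
    rw [Nat.add_comm, iterate_add_apply, hnx]

end Dwork

/-! ### Diagonals modulo the relations -/

namespace Dwork

open MvPolynomial Function

/-- The polynomial `c x ^ w` of a term `c * w`. -/
noncomputable def termPoly {n : ℕ} (t : Term n) : MvPolynomial (Fin n) K := t.1 • mono t.2

/-- The sum of the polynomials of a list of terms. -/
noncomputable def listPoly {n : ℕ} (l : List (Term n)) : MvPolynomial (Fin n) K :=
  (l.map termPoly).sum

/-- The multiset of the total degrees of a list of terms. -/
def degrees {n : ℕ} (l : List (Term n)) : Multiset ℕ := (l.map fun t => ∑ i, t.2 i : List ℕ)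

/-- The polynomial of the leftover of a term; it is `0` when there is none. -/
noncomputable def leftoverPoly {n : ℕ} (t : Term n) : MvPolynomial (Fin n) K :=
  match firstLarge t.2 with
  | none => 0
  | some i => termPoly (vTerm t i)

theorem leftoverPoly_mul {n : ℕ} (a : K) (t : Term n) :
    leftoverPoly (a * t.1, t.2) = a • leftoverPoly t := by
  unfold leftoverPoly
  rcases firstLarge t.2 with - | i
  · simp
  · simp only [termPoly, vTerm, smul_smul, mul_assoc]

/-- The difference is `c / n` times `D_i` of `x^w / x_i^n`. This monomial lies in `𝔏`, but not in
`𝔏^S` when `w_i = n`. -/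
theorem termPoly_sub_mem_relations {n : ℕ} (hn : 1 ≤ n) {t : Term n} (ht : IsPosExp t.2)
    {i : Fin n} (hi : n ≤ t.2 i) :
    termPoly t - termPoly (uTerm t i) - termPoly (vTerm t i) ∈ relations n := by
  obtain ⟨c, w⟩ := t
  dsimp only at ht hi
  have hn0 : (n : K) ≠ 0 := by exact_mod_cast (by omega : n ≠ 0)
  let v : Fin n → ℕ := fun j => if j = i then w j - n else w j
  have e1 : (fun j => (if j = i then n else 0) + v j) = w := by
    funext j
    by_cases hj : j = i
    · subst hj
      simp only [v, if_true]
      omega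
    · simp [v, hj]
  have e2 : (uTerm (c, w) i).2 = fun j => 1 + v j := by
    funext j
    by_cases hj : j = i
    · subst hj
      simp only [v, uTerm, if_true]
      omega
    · simp only [v, uTerm, hj, if_false]
      omega
  have hv : n ∣ ∑ j, v j := by
    have h := ht.2
    rw [← e1, Finset.sum_add_distrib] at h
    simpa using h
  have hD : D i (mono v) ∈ relations n :=
    Submodule.mem_iSup_of_mem i ⟨_, Submodule.subset_span ⟨v, hv, rfl⟩, rfl⟩
  have hvi : (v i : K) = w i - n := by
    simp only [v, if_true]
    push_cast [hi]
    rfl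
  rw [D_mono_eq, e1, hvi] at hD
  have h := (relations n).smul_mem (c / n) hD
  convert h using 1
  have e3 : (vTerm (c, w) i).2 = v := rfl
  simp only [termPoly, e2, e3, smul_sub, smul_add, smul_smul]
  have c1 : c / n * (n : K) = c := by field_simp
  have c2 : c / n * ((n : K) * lam) = (uTerm (c, w) i).1 := by
    simp only [uTerm]
    field_simp
  have c3 : c / n * ((w i : K) - n) = -(vTerm (c, w) i).1 := by
    simp only [vTerm]
    field_simp
    ring
  rw [c1, c2, c3, neg_smul]
  abel

/-- The `s`-th term of the diagonal starting at `t`, as long as the diagonal does not end. -/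
noncomputable def diagTerm {n : ℕ} (t : Term n) (s : ℕ) : Term n :=
  (lam ^ s * t.1, fire^[s] t.2)

theorem uTerm_diagTerm {n : ℕ} {t : Term n} {s : ℕ} {i : Fin n}
    (h : firstLarge (fire^[s] t.2) = some i) : uTerm (diagTerm t s) i = diagTerm t (s + 1) := by
  simp only [diagTerm, uTerm, iterate_succ_apply', fire_of_eq_some h, pow_succ]
  congr 1
  ring

/-- Telescoping of the one-step congruences. The general start `a` allows it to be applied to the
loop alone. -/
theorem termPoly_diagTerm_sub_mem {n : ℕ} (hn : 1 ≤ n) {t : Term n} (ht : IsPosExp t.2)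
    (a b : ℕ) (hns : ∀ s < b, firstLarge (fire^[a + s] t.2) ≠ none) :
    termPoly (diagTerm t a) - termPoly (diagTerm t (a + b)) -
      ((List.range b).map fun s => leftoverPoly (diagTerm t (a + s))).sum ∈ relations n := by
  induction b with
  | zero => simp
  | succ b ih =>
    obtain ⟨i, hi⟩ := exists_firstLarge_eq_some (hns b (by omega))
    have h1 := ih fun s hs => hns s (by omega)
    have h2 := termPoly_sub_mem_relations hn (t := diagTerm t (a + b)) (ht.iterate_fire _)
      (firstLarge_eq_some hi).1
    rw [uTerm_diagTerm hi] at h2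
    have h3 : leftoverPoly (diagTerm t (a + b)) = termPoly (vTerm (diagTerm t (a + b)) i) := by
      have : firstLarge (diagTerm t (a + b)).2 = some i := hi
      rw [leftoverPoly, this]
    convert (relations n).add_mem h1 h2 using 1
    rw [List.range_succ, List.map_append, List.sum_append, ← add_assoc]
    simp only [List.map_cons, List.map_nil, List.sum_cons, List.sum_nil, add_zero, h3]
    abel

/-! ### Bookkeeping for filed terms -/

theorem listPoly_addTerm {n : ℕ} (t : Term n) (l : List (Term n)) :
    listPoly (addTerm t l) = listPoly l + termPoly t := by
  induction l with
  | nil => simp [addTerm, listPoly]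
  | cons s l ih =>
    simp only [listPoly] at ih
    rw [addTerm]
    split_ifs with h
    · simp only [listPoly, List.map_cons, List.sum_cons, termPoly, add_smul, h]
      abel
    · simp only [listPoly, List.map_cons, List.sum_cons, ih]
      abel

theorem forall_mem_addTerm {n : ℕ} {P : (Fin n → ℕ) → Prop} {t : Term n} {l : List (Term n)}
    (ht : P t.2) (hl : ∀ s ∈ l, P s.2) : ∀ s ∈ addTerm t l, P s.2 := by
  induction l with
  | nil => simpa [addTerm] using ht
  | cons s l ih =>
    simp only [List.forall_mem_cons] at hl
    rw [addTerm]
    split_ifs with h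
    · simpa using hl
    · exact List.forall_mem_cons.2 ⟨hl.1, ih hl.2⟩

/-- Merging changes only a coefficient, so no degree is added in that case. -/
theorem degrees_addTerm {n : ℕ} (t : Term n) (l : List (Term n)) :
    degrees (addTerm t l) = degrees l ∨ degrees (addTerm t l) = degrees l + {∑ i, t.2 i} := by
  induction l with
  | nil => exact Or.inr rfl
  | cons s l ih =>
    rw [addTerm]
    split_ifs with h
    · exact Or.inl rfl
    · have hc : ∀ r : List (Term n), degrees (s :: r) = (∑ i, s.2 i) ::ₘ degrees r :=
        fun r => rfl
      rw [hc, hc]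
      rcases ih with ih | ih
      · exact Or.inl (by rw [ih])
      · exact Or.inr (by rw [ih, Multiset.cons_add])

/-- The exponents of finished terms lie in the box, those of the other terms are positive. -/
def Valid {n : ℕ} (LM : List (Term n) × List (Term n)) : Prop :=
  (∀ t ∈ LM.1, IsBoxExp t.2) ∧ ∀ t ∈ LM.2, IsPosExp t.2

/-- `LM'` arises from `LM` by filing terms with sum `p`, where only terms of degree less than `d`
go into the second list. -/
structure Filed {n : ℕ} (d : ℕ) (LM LM' : List (Term n) × List (Term n))
    (p : MvPolynomial (Fin n) K) : Prop where
  valid : Valid LM → Valid LM'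
  poly : listPoly LM'.1 + listPoly LM'.2 = listPoly LM.1 + listPoly LM.2 + p
  degrees : ∃ X : Multiset ℕ, (∀ x ∈ X, x < d) ∧ degrees LM'.2 = degrees LM.2 + X

theorem Filed.refl {n : ℕ} (d : ℕ) (LM : List (Term n) × List (Term n)) : Filed d LM LM 0 :=
  ⟨id, by simp, 0, by simp, by simp⟩

theorem Filed.trans {n : ℕ} {d : ℕ} {LM LM' LM'' : List (Term n) × List (Term n)}
    {p q : MvPolynomial (Fin n) K} (h : Filed d LM LM' p) (h' : Filed d LM' LM'' q) :
    Filed d LM LM'' (p + q) := by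
  obtain ⟨X, hX, hX'⟩ := h.degrees
  obtain ⟨Y, hY, hY'⟩ := h'.degrees
  refine ⟨h'.valid ∘ h.valid, by rw [h'.poly, h.poly, add_assoc], X + Y, fun x hx => ?_,
    by rw [hY', hX', add_assoc]⟩
  rcases Multiset.mem_add.1 hx with hx | hx
  exacts [hX x hx, hY x hx]

/-- The stable end of a diagonal has the full degree `d`; this is harmless because it goes into the
finished list, whose degrees are not tracked. -/
theorem filed_file {n : ℕ} {d : ℕ} (LM : List (Term n) × List (Term n)) {t : Term n}
    (ht : IsPosExp t.2) (hd : firstLarge t.2 = none ∨ ∑ i, t.2 i < d) :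
    Filed d LM (file LM t) (termPoly t) := by
  unfold file
  split_ifs with h
  · refine ⟨fun hv => ⟨forall_mem_addTerm ⟨fun i => ⟨ht.1 i, ?_⟩, ht.2⟩ hv.1, hv.2⟩, ?_, 0,
      by simp, by simp⟩
    · have := firstLarge_eq_none.1 h i
      omega
    · rw [listPoly_addTerm]
      abel
  · refine ⟨fun hv => ⟨hv.1, forall_mem_addTerm ht hv.2⟩, ?_, ?_⟩
    · rw [listPoly_addTerm]
      abel
    · rcases degrees_addTerm t LM.2 with h' | h'
      · exact ⟨0, by simp, by simpa using h'⟩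
      · exact ⟨{∑ i, t.2 i}, by simpa using hd.resolve_left h, h'⟩

theorem filed_fileLeftover {n : ℕ} (hn : 1 ≤ n) (LM : List (Term n) × List (Term n)) {t : Term n}
    (ht : IsPosExp t.2) :
    Filed (∑ i, t.2 i) LM (fileLeftover LM t) (leftoverPoly t) := by
  unfold fileLeftover leftoverPoly
  rcases h : firstLarge t.2 with - | i
  · exact Filed.refl _ _
  · have hi := (firstLarge_eq_some h).1
    dsimp only
    -- For `w_i = n` the leftover has coefficient zero, so discarding it loses nothing. Otherwise
    -- `w_i > n`, so the leftover keeps positive exponents and its degree drops by `n`.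
    split_ifs with hin
    · convert Filed.refl _ _
      simp [termPoly, vTerm, hin]
    · have hsum : ∑ j, (vTerm t i).2 j + n = ∑ j, t.2 j := by
        have : ∀ j, (vTerm t i).2 j + (if j = i then n else 0) = t.2 j := fun j => by
          by_cases hj : j = i
          · subst hj
            simp only [vTerm, if_true]
            omega
          · simp [vTerm, hj]
        rw [← Finset.sum_congr rfl fun j _ => this j, Finset.sum_add_distrib]
        simp
      refine filed_file LM ⟨fun j => ?_, ?_⟩ (Or.inr (by omega))
      · by_cases hj : j = i
        · subst hj
          simp only [vTerm, if_true]
          omega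
        · simpa [vTerm, hj] using ht.1 j
      · have := ht.2
        rw [← hsum] at this
        simpa using this

theorem filed_foldl_fileLeftover {n : ℕ} (hn : 1 ≤ n) {d : ℕ} (ts : List (Term n))
    (hts : ∀ t ∈ ts, IsPosExp t.2 ∧ ∑ i, t.2 i = d) (LM : List (Term n) × List (Term n)) :
    Filed d LM (ts.foldl fileLeftover LM) (ts.map leftoverPoly).sum := by
  induction ts generalizing LM with
  | nil => exact Filed.refl _ _
  | cons t ts ih =>
    rw [List.forall_mem_cons] at hts
    rw [List.foldl_cons, List.map_cons, List.sum_cons]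
    refine Filed.trans ?_ (ih hts.2 _)
    rw [← hts.1.2]
    exact filed_fileLeftover hn LM hts.1.1

/-! ### Running the algorithm and its termination -/

theorem step_iterate_running {n : ℕ} (Lst Mst : List (Term n)) (t : Term n) (k : ℕ)
    (hns : ∀ s < k, firstLarge (fire^[s] t.2) ≠ none)
    (hne : ∀ s' < k, ∀ s < s', fire^[s] t.2 ≠ fire^[s'] t.2) :
    step^[k] (.running Lst Mst [] t) =
      .running Lst Mst ((List.range k).map (diagTerm t)) (diagTerm t k) := by
  induction k with
  | zero => simp [diagTerm]
  | succ k ih =>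
    obtain ⟨i, hi⟩ := exists_firstLarge_eq_some (hns k (by omega))
    have hi' : firstLarge (diagTerm t k).2 = some i := hi
    rw [iterate_succ_apply', ih (fun s hs => hns s (by omega)) fun s' hs' => hne s' (by omega)]
    simp only [step, hi']
    rw [if_neg, uTerm_diagTerm hi, List.range_succ, List.map_append]
    · rfl
    · rw [List.findIdx_lt_length]
      rintro ⟨x, hx, hx'⟩
      obtain ⟨s, hs, rfl⟩ := List.mem_map.1 hx
      exact hne k (by omega) s (List.mem_range.1 hs) (of_decide_eq_true hx')

theorem one_sub_lam_pow_ne_zero {n : ℕ} (hn : 1 ≤ n) : (1 : K) - lam ^ n ≠ 0 := by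
  intro h
  have h1 : algebraMap (Polynomial ℂ) K (1 - Polynomial.X ^ n) = 0 := by
    rw [map_sub, map_one, map_pow, RatFunc.algebraMap_X, h]
  rw [map_eq_zero_iff _ (RatFunc.algebraMap_injective ℂ)] at h1
  have h2 := congrArg (Polynomial.eval 0) h1
  have hn0 : n ≠ 0 := by omega
  simp [hn0] at h2

/-- Processing one term: the diagonal ends after finitely many steps, and what gets filed is
congruent to the term. -/
theorem exists_step_iterate_eq_next {n : ℕ} (hn : 1 ≤ n) (Lst Mst : List (Term n)) {t : Term n}
    (ht : IsPosExp t.2) :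
    ∃ (N : ℕ) (LM : List (Term n) × List (Term n)) (p : MvPolynomial (Fin n) K),
      step^[N] (.running Lst Mst [] t) = next LM ∧
      Filed (∑ i, t.2 i) (Lst, Mst) LM p ∧ termPoly t - p ∈ relations n := by
  obtain ⟨k, hns, hne, hk⟩ := diagonal_ends hn t.2
  have hrun := step_iterate_running Lst Mst t k hns hne
  have hd0 : diagTerm t 0 = t := by simp [diagTerm]
  have hpos : ∀ s, IsPosExp (diagTerm t s).2 ∧ ∑ i, (diagTerm t s).2 i = ∑ i, t.2 i :=
    fun s => ⟨ht.iterate_fire s, sum_iterate_fire _ _⟩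
  rcases hk with hk | ⟨hk, j, rfl, hj⟩
  · have hk' : firstLarge (diagTerm t k).2 = none := hk
    refine ⟨k + 1, _, _, ?_, (filed_foldl_fileLeftover hn ((List.range k).map (diagTerm t)) ?_
      (Lst, Mst)).trans (filed_file _ (hpos k).1 (Or.inl hk')), ?_⟩
    · rw [iterate_succ_apply', hrun]
      simp only [step, hk']
    · intro x hx
      obtain ⟨s, -, rfl⟩ := List.mem_map.1 hx
      exact hpos s
    · have h := termPoly_diagTerm_sub_mem hn ht 0 k (by simpa using hns)
      simp only [Nat.zero_add, hd0] at h
      convert h using 1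
      rw [List.map_map]
      simp only [comp_def]
      abel
  · obtain ⟨i, hi⟩ := exists_firstLarge_eq_some hk
    have hi' : firstLarge (diagTerm t (j + n)).2 = some i := hi
    have hidx : ((List.range (j + n)).map (diagTerm t)).findIdx
        (fun x => decide (x.2 = (diagTerm t (j + n)).2)) = j := by
      rw [List.findIdx_eq (by simp; omega)]
      constructor
      · simpa [diagTerm] using hj
      · intro s hs
        simp only [List.getElem_map, List.getElem_range, decide_eq_false_iff_not]
        intro h
        exact hne j (by omega) s hs (h.trans hj.symm)
    let a : K := 1 - lam ^ n
    have ha : a ≠ 0 := one_sub_lam_pow_ne_zero hn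
    let ts : List (Term n) := (List.range j).map (diagTerm t) ++
      (List.range n).map fun s => (a⁻¹ * (diagTerm t (j + s)).1, (diagTerm t (j + s)).2)
    refine ⟨j + n + 1, ts.foldl fileLeftover (Lst, Mst), (ts.map leftoverPoly).sum, ?_,
      filed_foldl_fileLeftover hn ts ?_ _, ?_⟩
    · rw [iterate_succ_apply', hrun]
      simp only [step, hi', hidx]
      rw [if_pos (by simp; omega), List.range_add, List.map_append, List.take_left' (by simp),
        List.drop_left' (by simp), List.map_map, List.map_map]
      simp only [comp_def, ts, a, div_eq_inv_mul]
    · intro x hx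
      rcases List.mem_append.1 hx with hx | hx
      · obtain ⟨s, -, rfl⟩ := List.mem_map.1 hx
        exact hpos s
      · obtain ⟨s, -, rfl⟩ := List.mem_map.1 hx
        exact hpos (j + s)
    · have h1 := termPoly_diagTerm_sub_mem hn ht 0 j fun s hs => hns _ (by omega)
      have h2 := (relations n).smul_mem a⁻¹
        (termPoly_diagTerm_sub_mem hn ht j n fun s hs => hns _ (by omega))
      -- Once around the loop multiplies the term by `λ^n`, so the telescoped difference is `1 -
      -- λ^n` times the term entering the loop. Multiplying by `a⁻¹` isolates that term.
      have h3 : termPoly (diagTerm t (j + n)) = lam ^ n • termPoly (diagTerm t j) := by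
        simp only [termPoly, diagTerm, hj, smul_smul, pow_add]
        congr 1
        ring
      have h4 : a⁻¹ • (termPoly (diagTerm t j) - termPoly (diagTerm t (j + n))) =
          termPoly (diagTerm t j) := by
        have : termPoly (diagTerm t j) - termPoly (diagTerm t (j + n)) =
            a • termPoly (diagTerm t j) := by
          rw [h3, sub_smul, one_smul]
        rw [this, smul_smul, inv_mul_cancel₀ ha, one_smul]
      rw [smul_sub, h4] at h2
      simp only [Nat.zero_add, hd0] at h1
      convert (relations n).add_mem h1 h2 using 1
      simp only [ts, List.map_append, List.sum_append, List.map_map, comp_def, leftoverPoly_mul,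
        List.smul_sum]
      abel

/-- Processing a diagonal removes one degree from the waiting list and adds finitely many strictly
smaller ones, which is a descent in the well-founded Dershowitz–Manna order. -/
theorem exists_step_iterate_eq_halted {n : ℕ} (hn : 1 ≤ n) (S : Multiset ℕ)
    (LM : List (Term n) × List (Term n)) (hLM : Valid LM) (hS : degrees LM.2 = S) :
    ∃ (N : ℕ) (out : List (Term n)), step^[N] (next LM) = .halted out ∧
      (∀ t ∈ out, IsBoxExp t.2) ∧
      listPoly LM.1 + listPoly LM.2 - listPoly out ∈ relations n := by
  have hwf := Multiset.wellFounded_isDershowitzMannaLT (α := ℕ)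
  induction S using hwf.induction generalizing LM
  rename_i S ih
  obtain ⟨Lst, _ | ⟨t, Mst⟩⟩ := LM
  · exact ⟨0, Lst, rfl, hLM.1, by simp [listPoly]⟩
  · have hM := List.forall_mem_cons.1 hLM.2
    obtain ⟨N, LM', p, hN, hF, hp⟩ := exists_step_iterate_eq_next hn Lst Mst hM.1
    obtain ⟨X, hX, hX'⟩ := hF.degrees
    obtain ⟨N', out, hN', hout, hrel⟩ := ih (degrees LM'.2)
      ⟨degrees Mst, X, {∑ i, t.2 i}, by simp, hX', by
        rw [← hS, add_comm]
        rfl, fun x hx => ⟨_, Multiset.mem_singleton_self _, hX x hx⟩⟩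
      LM' (hF.valid ⟨hLM.1, hM.2⟩) rfl
    refine ⟨N' + N, out, ?_, hout, ?_⟩
    · rw [iterate_add_apply, next, hN, hN']
    · convert (relations n).add_mem hp hrel using 1
      rw [hF.poly]
      simp only [listPoly, List.map_cons, List.sum_cons]
      abel

theorem exists_mk_eq_sum_pmap {n : ℕ} (out : List (Term n)) (hout : ∀ t ∈ out, IsBoxExp t.2) :
    ∃ z : LS n, (z : MvPolynomial (Fin n) K) = listPoly out ∧
      (Submodule.Quotient.mk z : W n) =
        (out.pmap (fun t ht => t.1 • cls t.2 (IsBoxExp.isPosExp ht)) hout).sum := by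
  induction out with
  | nil => exact ⟨0, by simp [listPoly], by simp⟩
  | cons t out ih =>
    have h := List.forall_mem_cons.1 hout
    obtain ⟨z, hz, hz'⟩ := ih h.2
    refine ⟨t.1 • ⟨mono t.2, Submodule.subset_span ⟨t.2, h.1.isPosExp, rfl⟩⟩ + z, ?_, ?_⟩
    · simp [listPoly, termPoly, hz]
    · rw [Submodule.Quotient.mk_add, hz', List.pmap_cons, List.sum_cons]
      rfl

theorem exists_outputs {n : ℕ} (hn : 1 ≤ n) (c : K) (w : Fin n → ℕ) (hw : IsPosExp w) :
    ∃ out : List (Term n), Outputs c w out ∧ ∃ hout : ∀ t ∈ out, IsBoxExp t.2,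
      c • cls w hw =
        (out.pmap (fun t ht => t.1 • cls t.2 (IsBoxExp.isPosExp ht)) hout).sum := by
  -- The initial state is, by definition, `next` applied to an empty finished list and a waiting
  -- list holding only the input.
  obtain ⟨N, out, hN, hout, hrel⟩ := exists_step_iterate_eq_halted hn _ ([], [(c, w)])
    ⟨by simp, by simpa using hw⟩ rfl
  refine ⟨out, ⟨N, hN⟩, hout, ?_⟩
  obtain ⟨z, hz, hz'⟩ := exists_mk_eq_sum_pmap out hout
  rw [← hz', cls, ← Submodule.Quotient.mk_smul, Submodule.Quotient.eq, Submodule.mem_comap,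
    map_sub, map_smul]
  convert hrel using 1
  simp only [Submodule.subtype_apply, hz]
  simp [listPoly, termPoly]

theorem span_cls_eq_top {n : ℕ} (hn : 1 ≤ n) :
    Submodule.span K
      {z : W n | ∃ (w : Fin n → ℕ) (hw : IsBoxExp w), z = cls w hw.isPosExp} = ⊤ := by
  rw [eq_top_iff]
  rintro z -
  obtain ⟨⟨p, hp⟩, rfl⟩ := Submodule.Quotient.mk_surjective _ z
  induction hp using Submodule.span_induction with
  | mem p h =>
    obtain ⟨w, hw, rfl⟩ := h
    obtain ⟨out, -, hout, h⟩ := exists_outputs hn 1 w hw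
    rw [one_smul] at h
    change cls w hw ∈ _
    rw [h]
    refine list_sum_mem fun x hx => ?_
    obtain ⟨t, ht, rfl⟩ := List.mem_pmap.1 hx
    exact Submodule.smul_mem _ _ (Submodule.subset_span ⟨t.2, hout t ht, rfl⟩)
  | zero => exact Submodule.zero_mem _
  | add p q hp hq h1 h2 => exact Submodule.add_mem _ h1 h2
  | smul a p hp h => exact Submodule.smul_mem _ a h

/-- The classes of the monomials in `𝓑` form a basis of `𝓦`. -/
noncomputable def boxBasis {n : ℕ} (hn : 1 ≤ n) : Module.Basis (boxFinset n) K (W n) :=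
  Module.Basis.mk (linearIndependent_cls hn) <| by
    rw [← span_cls_eq_top hn]
    refine Submodule.span_mono ?_
    rintro _ ⟨w, hw, rfl⟩
    exact ⟨⟨w, mem_boxFinset.2 hw⟩, rfl⟩

end Dwork

theorem mainTheorem1 (n : ℕ) (hn : 1 ≤ n) :
    -- the reduction algorithm stops on every monomial of `𝔏^S`, and its output expresses
    -- the class of the monomial through monomials in `𝓑`
    (∀ (c : Dwork.K) (w : Fin n → ℕ) (hw : Dwork.IsPosExp w),
      ∃ out : List (Dwork.Term n), Dwork.Outputs c w out ∧
        ∃ hout : ∀ t ∈ out, Dwork.IsBoxExp t.2,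
          c • Dwork.cls w hw =
            (out.pmap (fun t ht => t.1 • Dwork.cls t.2 (Dwork.IsBoxExp.isPosExp ht)) hout).sum) ∧
    -- `𝓑` generates `𝓦`
    Submodule.span Dwork.K
      {z : Dwork.W n | ∃ (w : Fin n → ℕ) (hw : Dwork.IsBoxExp w), z = Dwork.cls w hw.isPosExp} = ⊤ ∧
    -- the dimension of `𝓦`
    Module.Finite Dwork.K (Dwork.W n) ∧
    (Module.finrank Dwork.K (Dwork.W n) : ℤ) =
      ∑ k ∈ Finset.Icc 1 (n - 1), (-1 : ℤ) ^ (n - 1 - k) * ((n : ℤ) - 1) ^ k := by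
  refine ⟨fun c w hw => Dwork.exists_outputs hn c w hw, Dwork.span_cls_eq_top hn,
    Module.Finite.of_basis (Dwork.boxBasis hn), ?_⟩
  rw [Module.finrank_eq_card_basis (Dwork.boxBasis hn), Fintype.card_coe, Dwork.card_boxFinset hn]
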